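/- Let $(\mathcal S,\mathcal A,r,P,\gamma,\rho_0)$ be a Markov decision process with finite $\mathcal S,\mathcal A$ and $\gamma\in[0,1)$, let $\pi$ be a stationary policy, and let $P^\pi((s,a),(s',a'))=P(s'\mid s,a)\,\pi(a'\mid s')$. For a reward $\rho:\mathcal S\times\mathcal A\to\mathbb R$ let $$Q^\pi_\rho(s,a)=\mathbb E_\pi\Big[\sum_{t\ge0}\gamma^t\rho(s_t,a_t)\,\Big|\,s_0=s,\,a_0=a\Big]=\sum_{t\ge 0}\gamma^t\big((P^\pi)^t\rho\big)(s,a)$$ be the Q value of $\pi$ for $\rho$. Let $\mathcal BQ=r+\gamma P^\pi Q$ be the Bellman backup operator, let $\mathbb E$ be the expectation over $(s,a)$ with respect to an arbitrary fixed probability distribution $d$ on $\mathcal S\times\mathcal A$, let $\beta\ge0$ and $\kappa\ge0$ with $\kappa\beta<1+\beta$, and for $Q:\mathcal S\times\mathcal A\to\mathbb R$ put $$C[Q]=\kappa\,\mathbb E[\mathcal BQ-Q],\qquad r_{\mathrm{erc}}[Q]=r-\tfrac{\beta}{1+\beta}C[Q]=r+\tfrac{\kappa\beta}{1+\beta}\,\mathbb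 E[Q-\mathcal BQ].$$ (The ERC update has $\kappa=2$, for which the condition reads $\beta<1$; for $\kappa=1$ it holds for every $\beta\ge0$.) Then there is exactly one function $Q_{\mathrm{reg}}$, the 1-eigensubspace regularized optimal Q value of $\pi$, that is the Q value of $\pi$ for the regularized reward it induces, i.e. $Q_{\mathrm{reg}}=Q^\pi_{r_{\mathrm{erc}}[Q_{\mathrm{reg}}]}$, and it equals the true Q value $Q^\pi_r$ of $\pi$. Moreover, for every $Q^0:\mathcal S\times\mathcal A\to\mathbb R$ and all learning rates $\alpha_k\ge0$ with $\sum_k\alpha_k=\infty$ and $\alpha_k(1+\beta)\le1$ for all large $k$ (in particular if $\sum_k\alpha_k=\infty$ and $\sum_k\alpha_k^2<\infty$), the ERC iterates $$Q^{k+1}=(1-\alpha_k(1+\beta))\,Q^k+\alpha_k(1+\beta)\,\mathcal BQ^k-\alpha_k\beta\,C[Q^k]$$ converge to $Q_{\mathrm{reg}}$ as $k\to\infty$. -/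

import Mathlib

open Filter Topology

namespace ERC

/-- A finite (tabular) Markov decision process `(S, A, R, P, γ, ρ₀)`. The elements of
`stdSimplex ℝ X` are the probability vectors on the finite type `X`. -/
structure MDP (S A : Type*) [Fintype S] [Fintype A] where
  /-- the reward function `r(s, a)` -/
  reward : S → A → ℝ
  /-- the transition kernel, `trans s a s' = P(s' | s, a)` -/
  trans : S → A → stdSimplex ℝ S
  /-- the discount factor -/
  γ : ℝ
  γ_nonneg : 0 ≤ γ
  γ_lt_one : γ < 1
  /-- the initial state distribution -/
  ρ₀ : stdSimplex ℝ S

/-- A stationary policy, `π s a = π(a | s)`. -/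
abbrev Policy (S A : Type*) [Fintype A] := S → stdSimplex ℝ A

section
variable {S A : Type*} [Fintype S] [Fintype A]

/-- The expectation `𝔼_{(s,a) ∼ d}[f(s,a)]`. -/
def expect (d : stdSimplex ℝ (S × A)) (f : S × A → ℝ) : ℝ :=
  ∑ x, (d : S × A → ℝ) x * f x

namespace MDP

variable (M : MDP S A) (π : Policy S A)

/-- The reward as a vector indexed by the state-action pairs. -/
def rewardVec : S × A → ℝ := fun x => M.reward x.1 x.2

/-- The transition matrix on state-action pairs,
`P^π((s,a),(s',a')) = P(s' | s, a) π(a' | s')`. -/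
def transMatrix : Matrix (S × A) (S × A) ℝ :=
  Matrix.of fun x y => (M.trans x.1 x.2 : S → ℝ) y.1 * (π y.1 : A → ℝ) y.2

/-- `M.expectAt π f t (s, a)` is `𝔼[f(s_t, a_t) | s_0 = s, a_0 = a]`, along the trajectories
induced by `π` and `P`, that is, `((P^π)^t f)(s, a)`. -/
def expectAt (f : S × A → ℝ) : ℕ → S × A → ℝ
  | 0 => f
  | t + 1 => Matrix.mulVec (M.transMatrix π) (expectAt f t)

/-- The Q value of the policy `π` for a reward vector `r`: the expected discounted return
`𝔼[∑ t, γ^t r(s_t, a_t) | s_0 = s, a_0 = a]`. The series converges absolutely, as the `t`-th term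
is bounded by `γ^t max |r|`. -/
noncomputable def qValue (r : S × A → ℝ) : S × A → ℝ :=
  fun x => ∑' t : ℕ, M.γ ^ t * M.expectAt π r t x

/-- The Bellman backup operator
`(𝓑 Q)(s,a) = r(s,a) + γ 𝔼_{s' ∼ P(· | s,a), a' ∼ π(· | s')}[Q(s',a')]`. -/
def bellman (Q : S × A → ℝ) : S × A → ℝ :=
  fun x => M.rewardVec x + M.γ * Matrix.mulVec (M.transMatrix π) Q x

variable (d : stdSimplex ℝ (S × A)) (κ β : ℝ)

/-- The correction `C = κ 𝔼_{(s,a) ∼ d}[𝓑Q - Q]`; the factor in the displayed update rule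
is `κ = 2`. -/
def correction (Q : S × A → ℝ) : ℝ :=
  κ * expect d (fun x => M.bellman π Q x - Q x)

/-- One ERC update with learning rate `a`:
`(1 - a (1+β)) Q + a (1+β) 𝓑Q - a β C`. -/
def ercUpdate (a : ℝ) (Q : S × A → ℝ) : S × A → ℝ :=
  fun x => (1 - a * (1 + β)) * Q x + a * (1 + β) * M.bellman π Q x
    - a * β * M.correction π d κ Q

/-- The 1-eigensubspace regularized reward induced by `Q`:
`r_erc = r - β/(1+β) C = r + κβ/(1+β) 𝔼[Q - 𝓑Q]`. -/
noncomputable def ercReward (Q : S × A → ℝ) : S × A → ℝ :=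
  fun x => M.rewardVec x - β / (1 + β) * M.correction π d κ Q

/-- `Q` is a 1-eigensubspace regularized Q value of `π`: it is the Q value of `π` for the
1-eigensubspace regularized reward that it induces itself. -/
def IsErcQValue (Q : S × A → ℝ) : Prop :=
  Q = M.qValue π (M.ercReward π d κ β Q)

end MDP

end

end ERC

/-! Everything is read off the Bellman residual `g = Q - 𝓑Q`. The correction is constant in `(s,a)`,
so the regularized equation says `g = c 𝔼[g]` with `c = κβ/(1+β) < 1`; averaging forces `𝔼[g] = 0`,
hence `g = 0`. Since `P^π` fixes constants, one update replaces `g` by a combination of `g`, `P^π g`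
and `𝔼[g]` (`ercUpdate_sub_bellman`). For small rates its coefficients are nonnegative, with sum `1
- (1-γ)(1+β-κβ)a`; averages do not increase the sup norm, so `‖g‖` shrinks by this factor.
Divergence of `∑ αₖ` sends `‖g‖` to zero, and `‖g‖/(1-γ)` bounds the distance to the Q value
(`norm_sub_qValue_le`). -/

namespace ERC

section
variable {S A : Type*} [Fintype S] [Fintype A]

/-- Averaging against a probability vector does not increase the sup norm. -/
theorem abs_sum_mul_le_norm {X : Type*} [Fintype X] (w v : X → ℝ) (hw : ∀ x, 0 ≤ w x)
    (hsum : ∑ x, w x = 1) : |∑ x, w x * v x| ≤ ‖v‖ :=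
  calc |∑ x, w x * v x| ≤ ∑ x, |w x * v x| := Finset.abs_sum_le_sum_abs _ _
    _ ≤ ∑ x, w x * ‖v‖ := by
        refine Finset.sum_le_sum fun x _ => ?_
        rw [abs_mul, abs_of_nonneg (hw x)]
        exact mul_le_mul_of_nonneg_left (norm_le_pi_norm v x) (hw x)
    _ = ‖v‖ := by rw [← Finset.sum_mul, hsum, one_mul]

theorem abs_expect_le_norm (d : stdSimplex ℝ (S × A)) (v : S × A → ℝ) : |expect d v| ≤ ‖v‖ :=
  abs_sum_mul_le_norm _ v d.2.1 d.2.2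

theorem expect_neg (d : stdSimplex ℝ (S × A)) (v : S × A → ℝ) : expect d (-v) = -expect d v := by
  simp [expect]

theorem expect_const (d : stdSimplex ℝ (S × A)) (c : ℝ) : expect d (fun _ => c) = c := by
  have h : ∑ x, (d : S × A → ℝ) x = 1 := d.2.2
  rw [expect, ← Finset.sum_mul, h, one_mul]

/-- A nonnegative sequence that eventually shrinks by factors `1 - δ aₖ` with `∑ aₖ = ∞` tends
to zero. -/
theorem tendsto_zero_of_le_one_sub_mul {u a : ℕ → ℝ} {δ : ℝ} (hδ : 0 < δ) (hu : ∀ k, 0 ≤ u k)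
    (hstep : ∀ᶠ k in atTop, u (k + 1) ≤ (1 - δ * a k) * u k)
    (ha : Tendsto (fun n => ∑ k ∈ Finset.range n, a k) atTop atTop) :
    Tendsto u atTop (𝓝 0) := by
  obtain ⟨K, hK⟩ := eventually_atTop.1 hstep
  set s : ℕ → ℝ := fun n => ∑ k ∈ Finset.range n, a k with hs
  -- By `1 - x ≤ exp (-x)` the product of factors becomes an exponential of partial sums, whatever
  -- the sign of `1 - δ aₖ`.
  have hbound : ∀ n ≥ K, u n ≤ u K * Real.exp (δ * s K) * Real.exp (-(δ * s n)) := by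
    intro n hn
    induction n, hn using Nat.le_induction with
    | base => rw [mul_assoc, ← Real.exp_add, add_neg_cancel, Real.exp_zero, mul_one]
    | succ n hn ih =>
      calc u (n + 1) ≤ (1 - δ * a n) * u n := hK n hn
        _ ≤ Real.exp (-(δ * a n)) * u n :=
            mul_le_mul_of_nonneg_right (Real.one_sub_le_exp_neg _) (hu n)
        _ ≤ Real.exp (-(δ * a n)) * (u K * Real.exp (δ * s K) * Real.exp (-(δ * s n))) :=
            mul_le_mul_of_nonneg_left ih (Real.exp_nonneg _)
        _ = u K * Real.exp (δ * s K) * (Real.exp (-(δ * s n)) * Real.exp (-(δ * a n))) := by ring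
        _ = u K * Real.exp (δ * s K) * Real.exp (-(δ * s (n + 1))) := by
            rw [← Real.exp_add]
            simp only [hs, Finset.sum_range_succ]
            ring_nf
  have hlim : Tendsto (fun n => u K * Real.exp (δ * s K) * Real.exp (-(δ * s n))) atTop (𝓝 0) := by
    simpa using (Real.tendsto_exp_neg_atTop_nhds_zero.comp
      (ha.const_mul_atTop hδ)).const_mul (u K * Real.exp (δ * s K))
  exact squeeze_zero' (Eventually.of_forall hu) (eventually_atTop.2 ⟨K, hbound⟩) hlim

namespace MDP

variable (M : MDP S A) (π : Policy S A)

theorem transMatrix_nonneg (x y : S × A) : 0 ≤ M.transMatrix π x y :=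
  mul_nonneg ((M.trans x.1 x.2).2.1 _) ((π y.1).2.1 _)

theorem sum_transMatrix (x : S × A) : ∑ y, M.transMatrix π x y = 1 := by
  simp only [transMatrix, Matrix.of_apply, Fintype.sum_prod_type, ← Finset.mul_sum]
  have h : ∀ s, ∑ a, (π s : A → ℝ) a = 1 := fun s => (π s).2.2
  simp only [h, mul_one]
  exact (M.trans x.1 x.2).2.2

theorem abs_transMatrix_mulVec_le (v : S × A → ℝ) (x : S × A) :
    |Matrix.mulVec (M.transMatrix π) v x| ≤ ‖v‖ :=
  abs_sum_mul_le_norm _ v (M.transMatrix_nonneg π x) (M.sum_transMatrix π x)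

theorem norm_transMatrix_mulVec_le (v : S × A → ℝ) :
    ‖Matrix.mulVec (M.transMatrix π) v‖ ≤ ‖v‖ :=
  (pi_norm_le_iff_of_nonneg (norm_nonneg _)).2 (M.abs_transMatrix_mulVec_le π v)

theorem transMatrix_mulVec_const (c : ℝ) :
    Matrix.mulVec (M.transMatrix π) (fun _ => c) = fun _ => c := by
  funext x
  simp only [Matrix.mulVec, dotProduct, ← Finset.sum_mul]
  rw [M.sum_transMatrix, one_mul]

theorem norm_expectAt_le (f : S × A → ℝ) (t : ℕ) : ‖M.expectAt π f t‖ ≤ ‖f‖ := by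
  induction t with
  | zero => exact le_rfl
  | succ t ih => exact (M.norm_transMatrix_mulVec_le π _).trans ih

theorem summable_expectAt (f : S × A → ℝ) (x : S × A) :
    Summable fun t : ℕ => M.γ ^ t * M.expectAt π f t x := by
  refine Summable.of_norm_bounded
    ((summable_geometric_of_lt_one M.γ_nonneg M.γ_lt_one).mul_right ‖f‖) fun t => ?_
  rw [norm_mul, Real.norm_of_nonneg (pow_nonneg M.γ_nonneg t)]
  exact mul_le_mul_of_nonneg_left ((norm_le_pi_norm _ x).trans (M.norm_expectAt_le π f t))
    (pow_nonneg M.γ_nonneg t)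

/-- The Bellman equation for the Q value. -/
theorem qValue_eq (f : S × A → ℝ) :
    M.qValue π f = f + M.γ • Matrix.mulVec (M.transMatrix π) (M.qValue π f) := by
  funext x
  have hsum : M.γ * Matrix.mulVec (M.transMatrix π) (M.qValue π f) x
      = ∑' t : ℕ, M.γ ^ (t + 1) * M.expectAt π f (t + 1) x := by
    simp only [Matrix.mulVec, dotProduct, qValue, ← tsum_mul_left]
    rw [← Summable.tsum_finsetSum fun y _ => (M.summable_expectAt π f y).mul_left _,
      ← tsum_mul_left]
    refine tsum_congr fun t => ?_
    simp only [expectAt, Matrix.mulVec, dotProduct, Finset.mul_sum]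
    exact Finset.sum_congr rfl fun y _ => by ring
  rw [Pi.add_apply, Pi.smul_apply, smul_eq_mul, hsum]
  simp only [qValue]
  rw [(M.summable_expectAt π f x).tsum_eq_zero_add]
  simp [expectAt]

/-- The resolvent of `γ P^π` is bounded by `1 / (1 - γ)` in the sup norm. -/
theorem norm_le_of_eq_add {u w : S × A → ℝ}
    (h : u = w + M.γ • Matrix.mulVec (M.transMatrix π) u) : (1 - M.γ) * ‖u‖ ≤ ‖w‖ := by
  have h1 : ‖u‖ ≤ ‖w‖ + M.γ * ‖u‖ :=
    calc ‖u‖ = ‖w + M.γ • Matrix.mulVec (M.transMatrix π) u‖ := congrArg _ h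
      _ ≤ ‖w‖ + ‖M.γ • Matrix.mulVec (M.transMatrix π) u‖ := norm_add_le _ _
      _ ≤ ‖w‖ + M.γ * ‖u‖ := by
          rw [norm_smul, Real.norm_of_nonneg M.γ_nonneg]
          exact add_le_add_right
            (mul_le_mul_of_nonneg_left (M.norm_transMatrix_mulVec_le π u) M.γ_nonneg) _
  linarith

/-- The distance to the Q value is controlled by the residual of the Bellman equation. -/
theorem norm_sub_qValue_le (f Q : S × A → ℝ) :
    (1 - M.γ) * ‖Q - M.qValue π f‖
      ≤ ‖Q - (f + M.γ • Matrix.mulVec (M.transMatrix π) Q)‖ := by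
  refine M.norm_le_of_eq_add π ?_
  rw [Matrix.mulVec_sub, smul_sub]
  nth_rewrite 1 [M.qValue_eq π f]
  abel

/-- A zero residual forces zero distance to the Q value, so the series can be traded for a linear
equation. -/
theorem eq_qValue_iff (f Q : S × A → ℝ) :
    Q = M.qValue π f ↔ Q = f + M.γ • Matrix.mulVec (M.transMatrix π) Q := by
  refine ⟨fun h => h ▸ M.qValue_eq π f, fun h => ?_⟩
  have h1 := M.norm_sub_qValue_le π f Q
  rw [sub_eq_zero.2 h, norm_zero] at h1
  have h2 : ‖Q - M.qValue π f‖ ≤ 0 :=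
    nonpos_of_mul_nonpos_right h1 (sub_pos.2 M.γ_lt_one)
  exact sub_eq_zero.1 (norm_le_zero_iff.1 h2)

theorem bellman_eq (Q : S × A → ℝ) :
    M.bellman π Q = M.rewardVec + M.γ • Matrix.mulVec (M.transMatrix π) Q := rfl

variable (d : stdSimplex ℝ (S × A)) (κ β : ℝ)

theorem correction_eq (Q : S × A → ℝ) :
    M.correction π d κ Q = -(κ * expect d (Q - M.bellman π Q)) := by
  rw [← mul_neg, ← expect_neg, neg_sub]
  rfl

variable {κ β}

/-- The regularization leaves the Q value of the policy unchanged. -/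
theorem isErcQValue_iff (hβ : 0 ≤ β) (hκβ : κ * β < 1 + β) (Q : S × A → ℝ) :
    M.IsErcQValue π d κ β Q ↔ Q = M.qValue π M.rewardVec := by
  have hβ' : 0 < 1 + β := by linarith
  set c := β / (1 + β) * κ with hc_def
  have hc : c < 1 := by
    rw [hc_def, div_mul_eq_mul_div, div_lt_one hβ']
    linarith
  set g := Q - M.bellman π Q with hg
  have hres : Q - (M.ercReward π d κ β Q + M.γ • Matrix.mulVec (M.transMatrix π) Q)
      = g - fun _ => c * expect d g := by
    funext x
    simp only [ercReward, correction_eq, hg, bellman_eq, Pi.sub_apply, Pi.add_apply, hc_def]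
    ring
  rw [IsErcQValue, eq_qValue_iff, eq_qValue_iff, ← bellman_eq, ← sub_eq_zero, hres,
    ← sub_eq_zero (a := Q), ← hg, sub_eq_zero]
  constructor
  · intro h
    -- `h` makes `g` constant, and a constant is its own expectation.
    have hE : expect d g = c * expect d g := by
      conv_lhs => rw [h]
      exact expect_const d _
    have hE0 : expect d g = 0 := by
      have : (1 - c) * expect d g = 0 := by linarith
      exact (mul_eq_zero.1 this).resolve_left (by linarith)
    rw [h, hE0, mul_zero]
    rfl
  · intro h
    rw [h]
    funext x
    simp [expect]

/-- The evolution of the Bellman residual under one ERC update. -/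
theorem ercUpdate_sub_bellman (a : ℝ) (Q : S × A → ℝ) :
    M.ercUpdate π d κ β a Q - M.bellman π (M.ercUpdate π d κ β a Q)
      = fun x => (1 - a * (1 + β)) * (Q - M.bellman π Q) x
        + a * (1 + β) * M.γ * Matrix.mulVec (M.transMatrix π) (Q - M.bellman π Q) x
        + a * (κ * β) * (1 - M.γ) * expect d (Q - M.bellman π Q) := by
  set g := Q - M.bellman π Q with hg
  -- The update is a step along `-g` plus a constant; applying `1 - γ P^π` scales that constant by
  -- `1 - γ`.
  have hup : M.ercUpdate π d κ β a Q
      = Q - (a * (1 + β)) • g + fun _ => a * (κ * β) * expect d g := by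
    funext x
    simp only [ercUpdate, correction_eq, hg, Pi.sub_apply, Pi.add_apply, Pi.smul_apply,
      smul_eq_mul]
    ring
  have hgx : ∀ x, g x = Q x - (M.rewardVec x + M.γ * Matrix.mulVec (M.transMatrix π) Q x) :=
    fun _ => rfl
  funext x
  rw [hup, bellman_eq, Matrix.mulVec_add, Matrix.mulVec_sub, Matrix.mulVec_smul,
    transMatrix_mulVec_const]
  simp only [Pi.sub_apply, Pi.add_apply, Pi.smul_apply, smul_eq_mul]
  linear_combination -(hgx x)

/-- An ERC update with small learning rate contracts the Bellman residual in the sup norm. -/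
theorem norm_ercUpdate_sub_bellman_le (hβ : 0 ≤ β) (hκ : 0 ≤ κ) {a : ℝ} (ha : 0 ≤ a)
    (ha' : a * (1 + β) ≤ 1) (Q : S × A → ℝ) :
    ‖M.ercUpdate π d κ β a Q - M.bellman π (M.ercUpdate π d κ β a Q)‖
      ≤ (1 - (1 - M.γ) * (1 + β - κ * β) * a) * ‖Q - M.bellman π Q‖ := by
  rw [ercUpdate_sub_bellman]
  set g := Q - M.bellman π Q
  have hγ := M.γ_nonneg
  have hγ' : 0 ≤ 1 - M.γ := sub_nonneg.2 M.γ_lt_one.le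
  have h1 : 0 ≤ 1 - a * (1 + β) := sub_nonneg.2 ha'
  have h2 : 0 ≤ a * (1 + β) * M.γ := by positivity
  have h3 : 0 ≤ a * (κ * β) * (1 - M.γ) := by positivity
  have hpt : ∀ x, |(1 - a * (1 + β)) * g x
        + a * (1 + β) * M.γ * Matrix.mulVec (M.transMatrix π) g x
        + a * (κ * β) * (1 - M.γ) * expect d g|
      ≤ (1 - (1 - M.γ) * (1 + β - κ * β) * a) * ‖g‖ := fun x =>
    calc _ ≤ |(1 - a * (1 + β)) * g x|
          + |a * (1 + β) * M.γ * Matrix.mulVec (M.transMatrix π) g x|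
          + |a * (κ * β) * (1 - M.γ) * expect d g| := abs_add_three _ _ _
      _ ≤ (1 - a * (1 + β)) * ‖g‖ + a * (1 + β) * M.γ * ‖g‖
          + a * (κ * β) * (1 - M.γ) * ‖g‖ := by
        rw [abs_mul _ (g x), abs_mul _ (Matrix.mulVec _ g x), abs_mul _ (expect d g),
          abs_of_nonneg h1, abs_of_nonneg h2, abs_of_nonneg h3]
        exact add_le_add (add_le_add
          (mul_le_mul_of_nonneg_left (norm_le_pi_norm g x) h1)
          (mul_le_mul_of_nonneg_left (M.abs_transMatrix_mulVec_le π g x) h2))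
          (mul_le_mul_of_nonneg_left (abs_expect_le_norm d g) h3)
      _ = _ := by ring
  -- On a nonempty index type the pointwise bound suffices, with no separate proof that the right
  -- side is nonnegative; `d` has total mass 1, which excludes the empty type.
  have hne : Nonempty (S × A) := by
    by_contra hempty
    rw [not_nonempty_iff] at hempty
    simpa using d.2.2
  exact (pi_norm_le_iff_of_nonempty _).2 hpt

theorem tendsto_of_ercUpdate (hβ : 0 ≤ β) (hκ : 0 ≤ κ) (hκβ : κ * β < 1 + β) {α : ℕ → ℝ}
    {Q : ℕ → S × A → ℝ} (hα : ∀ k, 0 ≤ α k) (hα' : ∀ᶠ k in atTop, α k * (1 + β) ≤ 1)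
    (hsum : Tendsto (fun n => ∑ k ∈ Finset.range n, α k) atTop atTop)
    (hQ : ∀ k, Q (k + 1) = M.ercUpdate π d κ β (α k) (Q k)) :
    Tendsto Q atTop (𝓝 (M.qValue π M.rewardVec)) := by
  have hγ : 0 < 1 - M.γ := sub_pos.2 M.γ_lt_one
  have hres : Tendsto (fun k => ‖Q k - M.bellman π (Q k)‖) atTop (𝓝 0) :=
    tendsto_zero_of_le_one_sub_mul (mul_pos hγ (sub_pos.2 hκβ)) (fun k => norm_nonneg _)
      (hα'.mono fun k hk => by
        rw [hQ k]
        exact M.norm_ercUpdate_sub_bellman_le π d hβ hκ (hα k) hk (Q k)) hsum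
  rw [tendsto_iff_norm_sub_tendsto_zero]
  refine squeeze_zero (fun k => norm_nonneg _) (fun k => ?_)
    (by simpa using hres.div_const (1 - M.γ))
  rw [le_div_iff₀ hγ, mul_comm]
  exact M.norm_sub_qValue_le π M.rewardVec (Q k)

end MDP

end

end ERC

theorem theorem2 {S A : Type*} [Fintype S] [Fintype A]
    (M : ERC.MDP S A) (π : ERC.Policy S A) (d : stdSimplex ℝ (S × A))
    (β κ : ℝ) (hβ : 0 ≤ β) (hκ : 0 ≤ κ) (hκβ : κ * β < 1 + β) :
    ∃ Qreg : S × A → ℝ,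
      (∀ Q : S × A → ℝ, M.IsErcQValue π d κ β Q ↔ Q = Qreg) ∧
      Qreg = M.qValue π M.rewardVec ∧
      ∀ (α : ℕ → ℝ) (Q : ℕ → S × A → ℝ),
        (∀ k, 0 ≤ α k) →
        (∀ᶠ k in atTop, α k * (1 + β) ≤ 1) →
        Tendsto (fun n => ∑ k ∈ Finset.range n, α k) atTop atTop →
        (∀ k, Q (k + 1) = M.ercUpdate π d κ β (α k) (Q k)) →
        Tendsto Q atTop (𝓝 Qreg) := by
  exact ⟨M.qValue π M.rewardVec, M.isErcQValue_iff π d hβ hκβ, rfl,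
    fun _ _ hα hα' hsum hQ => M.tendsto_of_ercUpdate π d hβ hκ hκβ hα hα' hsum hQ⟩
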